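/- Let $\alpha,\beta\ge 0$. Call an additive subgroup $\mathcal C\subseteq\mathbb Z_2^\alpha\times\mathbb Z_4^\beta$ a *$\mathbb Z_2\mathbb Z_4$-additive code*. Let $\Phi:\mathbb Z_2^\alpha\times\mathbb Z_4^\beta\to\mathbb Z_2^{\alpha+2\beta}$ be the map that is the identity on the binary coordinates and the Gray map $0\mapsto00,\ 1\mapsto01,\ 2\mapsto11,\ 3\mapsto10$ on each quaternary coordinate. The code $\mathcal C$ is *1-perfect* if every vector of $\mathbb Z_2^{\alpha+2\beta}$ is at Hamming distance at most $1$ from exactly one element of $\Phi(\mathcal C)$. Its *extended code* $\mathcal C'\subseteq\mathbb Z_2^{\alpha+1}\times\mathbb Z_4^\beta$ is obtained by inserting into each codeword $\mathbf u\in\mathcal C$ one further binary coordinate, at a fixed position among the binary coordinates, equal to the sum modulo $2$ of all bits of $\Phi(\mathbf u)$. A $\mathbb Z_2\mathbb Z_4$-additive code is *$\mathbb Z_2\mathbb Z_4$-cyclic* if it is closed under the double right cyclic shift $$(u_1,\dots,u_a\mid u'_1,\dots,u'_b)\mapsto(u_a,u_1,\dots,u_{a-1}\mid u'_b,u'_1,\dots,u'_{b-1}).$$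 **Theorem.** Let $t\ge 3$ and let $\mathcal C\subseteq\mathbb Z_2^\alpha\times\mathbb Z_4^\beta$ be a $\mathbb Z_2\mathbb Z_4$-additive 1-perfect code of binary length $\alpha+2\beta=2^t-1$. Then, whatever the position of the parity coordinate among the binary coordinates, the extended code $\mathcal C'$ is not $\mathbb Z_2\mathbb Z_4$-cyclic. (In particular this holds for the codes $\mathcal C'_{r,t}$ with $t\ge3$, where for $2\le r\le t\le 2r$ one denotes by $\mathcal C_{r,t}$ a $\mathbb Z_2\mathbb Z_4$-additive 1-perfect code with $\alpha=2^r-1$ and $\beta=2^{t-1}-2^{r-1}$.) -/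

import Mathlib

/-- The ambient group `ℤ₂^α × ℤ₄^β`; a `ℤ₂ℤ₄`-additive code is an additive subgroup of it. -/
abbrev Z2Z4 (α β : ℕ) : Type := (Fin α → ZMod 2) × (Fin β → ZMod 4)

/-- The classical Gray map `ℤ₄ → ℤ₂²`: `0 ↦ 00`, `1 ↦ 01`, `2 ↦ 11`, `3 ↦ 10`. -/
def gray (a : ZMod 4) : Fin 2 → ZMod 2 :=
  if a = 0 then ![0, 0] else if a = 1 then ![0, 1] else if a = 2 then ![1, 1] else ![1, 0]

/-- The extended Gray map `Φ (u | u') = (u | φ(u'₁), …, φ(u'_β))`. Its `α + 2β` binary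
coordinate positions are indexed by `Fin α ⊕ Fin β × Fin 2`. -/
def grayMap {α β : ℕ} (u : Z2Z4 α β) : Fin α ⊕ Fin β × Fin 2 → ZMod 2 :=
  Sum.elim u.1 (fun k => gray (u.2 k.1) k.2)

/-- A binary code is 1-perfect if every binary vector is at Hamming distance at most one from
exactly one codeword. -/
def IsOnePerfect {ι : Type*} [Fintype ι] (C : Set (ι → ZMod 2)) : Prop :=
  ∀ v : ι → ZMod 2, ∃! c : ι → ZMod 2, c ∈ C ∧ hammingDist v c ≤ 1

/-- A `ℤ₂ℤ₄`-additive code is 1-perfect if its binary Gray image is. -/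
def IsAdditiveOnePerfect {α β : ℕ} (C : AddSubgroup (Z2Z4 α β)) : Prop :=
  IsOnePerfect (grayMap '' (C : Set (Z2Z4 α β)))

/-- The right cyclic shift `(v₁, …, v_m) ↦ (v_m, v₁, …, v_{m-1})`. -/
def cyclicShift {R : Type*} {m : ℕ} (v : Fin m → R) : Fin m → R :=
  fun i => v ((finRotate m).symm i)

/-- The double right cyclic shift `σ (u | u') = (σ u | σ u')`. -/
def doubleShift {α β : ℕ} (u : Z2Z4 α β) : Z2Z4 α β :=
  (cyclicShift u.1, cyclicShift u.2)

/-- A `ℤ₂ℤ₄`-additive code is `ℤ₂ℤ₄`-cyclic if it is closed under the double cyclic shift. -/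
def IsZ2Z4Cyclic {α β : ℕ} (C : AddSubgroup (Z2Z4 α β)) : Prop :=
  ∀ x ∈ C, doubleShift x ∈ C

/-- The parity bit of `u`: the sum modulo 2 of all the bits of its Gray image. -/
def parityBit {α β : ℕ} (u : Z2Z4 α β) : ZMod 2 := ∑ k, grayMap u k

theorem gray_sum_add (a b : ZMod 4) :
    ∑ j, gray (a + b) j = ∑ j, gray a j + ∑ j, gray b j := by
  revert a b; decide

theorem parityBit_eq {α β : ℕ} (u : Z2Z4 α β) :
    parityBit u = ∑ i, u.1 i + ∑ j, ∑ b, gray (u.2 j) b := by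
  simp [parityBit, grayMap, Fintype.sum_prod_type]

theorem parityBit_add {α β : ℕ} (u v : Z2Z4 α β) :
    parityBit (u + v) = parityBit u + parityBit v := by
  simp only [parityBit_eq, Prod.fst_add, Prod.snd_add, Pi.add_apply, gray_sum_add,
    Finset.sum_add_distrib]
  abel

/-- Adding an even parity check coordinate to a vector, as the `p`-th of the now `α + 1`
binary coordinates. -/
def extendHom {α β : ℕ} (p : Fin (α + 1)) : Z2Z4 α β →+ Z2Z4 (α + 1) β :=
  AddMonoidHom.mk'
    (fun u => (Fin.insertNth (α := fun _ => ZMod 2) p (parityBit u) u.1, u.2))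
    (by
      intro u v
      refine Prod.ext ?_ rfl
      funext i
      refine Fin.succAboveCases p ?_ (fun j => ?_) i
      · simp [parityBit_add]
      · simp)

/-- The extended code: an even parity check coordinate, at position `p` of the binary part, is
added to each codeword. -/
def extendedCode {α β : ℕ} (p : Fin (α + 1)) (C : AddSubgroup (Z2Z4 α β)) :
    AddSubgroup (Z2Z4 (α + 1) β) :=
  C.map (extendHom p)

/-!
Let `G` be the quotient of the ambient group by the extended code. Perfectness says that the odd
elements of `G` are exactly the cosets `e i` (of order two) and `±f j` (of order four) of the unit
errors, without repetition, and the shift permutes the `e i` and the `f j` each as a single cycle.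

On the elements of `G` killed by `2`, an `𝔽₂`-space with odd hyperplane `{e i}`, the order of the
shift is `α + 1`, which is half the size of the space. So it is a power of two and the shift is
unipotent, but a unipotent map of a `d`-dimensional space over `𝔽₂` with `2 ^ (d - 1) > 4` has
order less than `2 ^ (d - 1)`; hence `α + 1 ≤ 4`. Moreover the shift fixes at most one nonzero
even vector.

The nonzero elements of `2G` are the `2 • f j`, which form a single orbit. A unipotent map has a
fixed vector in every nonzero invariant subspace, so all `2 • f j` are equal; then adding
`f 0 + e 0` sends the `±f j` into `{e i}`, and `2β ≤ α + 1`. Finally `β ≠ 2`, so `α + 1 + 2β < 8`.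
-/

section Unipotent

open Polynomial in
theorem sub_one_pow_char_pow {K A : Type*} [CommRing K] [Ring A] [Algebra K A] (p : ℕ)
    [Fact p.Prime] [CharP K p] (x : A) (n : ℕ) : (x - 1) ^ p ^ n = x ^ p ^ n - 1 := by
  have hX : (X - 1 : K[X]) ^ p ^ n = X ^ p ^ n - 1 := by rw [sub_pow_char_pow, one_pow]
  simpa using congrArg (aeval x) hX

variable {K V : Type*} [Field K] [AddCommGroup V] [Module K V]

open Polynomial in
theorem pow_finrank_eq_zero_of_isNilpotent [FiniteDimensional K V] {N : Module.End K V}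
    (hN : IsNilpotent N) : N ^ Module.finrank K V = 0 := by
  simpa [hN.charpoly_eq_X_pow_finrank] using N.aeval_self_charpoly

theorem pow_char_pow_eq_one_of_finrank_le [FiniteDimensional K V] (p : ℕ) [Fact p.Prime]
    [CharP K p] {T : Module.End K V} (hT : IsNilpotent (T - 1)) {n : ℕ}
    (hn : Module.finrank K V ≤ p ^ n) : T ^ p ^ n = 1 := by
  have hpow : (T - 1) ^ p ^ n = 0 :=
    pow_eq_zero_of_le hn (pow_finrank_eq_zero_of_isNilpotent hT)
  rwa [sub_one_pow_char_pow (K := K), sub_eq_zero] at hpow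

end Unipotent

theorem exists_pow_apply_mem_ker_of_isNilpotent {R M : Type*} [Semiring R] [AddCommMonoid M]
    [Module R M] {N : Module.End R M} (hN : IsNilpotent N) {x : M} (hx : x ≠ 0) :
    ∃ n, (N ^ n) x ≠ 0 ∧ N ((N ^ n) x) = 0 := by
  classical
  have hex : ∃ n, (N ^ n) x = 0 := hN.imp fun n hn => by rw [hn, LinearMap.zero_apply]
  obtain ⟨n, hn⟩ : ∃ n, Nat.find hex = n + 1 :=
    Nat.exists_eq_succ_of_ne_zero fun h => hx <| by simpa [h] using Nat.find_spec hex
  refine ⟨n, Nat.find_min hex (by omega), ?_⟩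
  rw [← Module.End.mul_apply, ← pow_succ', ← hn]
  exact Nat.find_spec hex

theorem val_finRotate_iterate {m : ℕ} (n : ℕ) (i : Fin (m + 1)) :
    ((finRotate (m + 1))^[n] i).val = (i + n) % (m + 1) := by
  induction n with
  | zero => exact (Nat.mod_eq_of_lt i.isLt).symm
  | succ n ih =>
    rw [Function.iterate_succ_apply', finRotate_apply, Fin.val_add, ih, Fin.val_one',
      ← Nat.add_mod, add_assoc]

theorem exists_finRotate_iterate_eq {m : ℕ} (i j : Fin m) : ∃ n, (finRotate m)^[n] i = j := by
  have : NeZero m := i.neZero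
  refine ⟨(j - i).val, ?_⟩
  rw [← finCycle_eq_finRotate_iterate, finCycle_apply, add_sub_cancel]

theorem fin_eq_of_add_self_eq_zero {m : ℕ} {k l : Fin (m + 1)} (hk : k ≠ 0) (hl : l ≠ 0)
    (hkk : k + k = 0) (hll : l + l = 0) : k = l := by
  simp only [Fin.ext_iff, Fin.val_add_eq_ite, Fin.val_zero, ne_eq] at *
  split_ifs at hkk hll <;> omega

/-- The affine hyperplane `π = 1` of a space over `𝔽₂` is enumerated by `w` in such a way that the
endomorphism `T` permutes it as a single cycle. -/
structure IsCyclicHyperplane {V : Type*} [AddCommGroup V] [Module (ZMod 2) V] {a : ℕ}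
    (T : Module.End (ZMod 2) V) (π : V →+ ZMod 2) (w : Fin (a + 1) → V) : Prop where
  injective : Function.Injective w
  range_eq : Set.range w = {x | π x = 1}
  semiconj : Function.Semiconj w (finRotate (a + 1)) T

namespace IsCyclicHyperplane

variable {V : Type*} [AddCommGroup V] [Module (ZMod 2) V] {a : ℕ} {T : Module.End (ZMod 2) V}
  {π : V →+ ZMod 2} {w : Fin (a + 1) → V}

theorem map_eq_one (h : IsCyclicHyperplane T π w) (i : Fin (a + 1)) : π (w i) = 1 :=
  h.range_eq.subset (Set.mem_range_self i)

theorem exists_eq_add_of_map_eq_zero (h : IsCyclicHyperplane T π w) {x : V} (hx : π x = 0)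
    (i : Fin (a + 1)) : ∃ k, w k = w i + x :=
  h.range_eq.superset (by simp [h.map_eq_one, hx])

theorem pow_eq_one_iff (h : IsCyclicHyperplane T π w) (n : ℕ) : T ^ n = 1 ↔ a + 1 ∣ n := by
  have hpow : ∀ i, (T ^ n) (w i) = w ((finRotate (a + 1))^[n] i) := fun i => by
    rw [Module.End.pow_apply, (h.semiconj.iterate_right n).eq]
  constructor
  · intro hT
    have hfix : w ((finRotate (a + 1))^[n] 0) = w 0 := by
      rw [← hpow, hT, Module.End.one_apply]
    have hval := congrArg Fin.val (h.injective hfix)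
    rw [val_finRotate_iterate, Fin.val_zero, zero_add] at hval
    exact Nat.dvd_of_mod_eq_zero hval
  · rintro ⟨m, rfl⟩
    have hfix : ∀ i, (T ^ ((a + 1) * m)) (w i) = w i := fun i => by
      rw [hpow]
      congr 1
      ext
      rw [val_finRotate_iterate, Nat.add_mul_mod_self_left, Nat.mod_eq_of_lt i.isLt]
    ext x
    rcases (by decide : ∀ c : ZMod 2, c = 0 ∨ c = 1) (π x) with hx | hx
    · obtain ⟨k, hk⟩ := h.exists_eq_add_of_map_eq_zero hx 0
      rw [← sub_eq_of_eq_add' hk, map_sub, hfix, hfix, Module.End.one_apply]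
    · obtain ⟨k, rfl⟩ := h.range_eq.superset hx
      exact hfix k

theorem card_eq (h : IsCyclicHyperplane T π w) : 2 * (a + 1) = Nat.card V := by
  have hker : Nat.card π.ker = a + 1 := by
    let φ : Fin (a + 1) → π.ker := fun i => ⟨w i - w 0, by
      rw [AddMonoidHom.mem_ker, map_sub, h.map_eq_one, h.map_eq_one, sub_self]⟩
    have hφ : Function.Bijective φ := by
      refine ⟨fun i j hij => h.injective (sub_left_injective (congrArg Subtype.val hij)), ?_⟩
      rintro ⟨x, hx⟩
      obtain ⟨k, hk⟩ := h.exists_eq_add_of_map_eq_zero hx 0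
      exact ⟨k, Subtype.ext (sub_eq_of_eq_add' hk)⟩
    rw [← Nat.card_eq_of_bijective φ hφ, Nat.card_fin]
  have hrange : π.range = ⊤ := by
    refine AddMonoidHom.range_eq_top.2 fun c => ?_
    rcases (by decide : ∀ c : ZMod 2, c = 0 ∨ c = 1) c with rfl | rfl
    · exact ⟨0, map_zero π⟩
    · exact ⟨w 0, h.map_eq_one 0⟩
  rw [← AddSubgroup.card_mul_index π.ker, hker, AddSubgroup.index_ker, hrange, mul_comm,
    Nat.card_congr AddSubgroup.topEquiv.toEquiv, Nat.card_zmod]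

theorem finite (h : IsCyclicHyperplane T π w) : Finite V :=
  Nat.finite_of_card_ne_zero (h.card_eq ▸ by positivity)

theorem isNilpotent_sub_one (h : IsCyclicHyperplane T π w) : IsNilpotent (T - 1) := by
  have := h.finite
  refine ⟨2 ^ Module.finrank (ZMod 2) V, ?_⟩
  rw [sub_one_pow_char_pow (K := ZMod 2), sub_eq_zero, h.pow_eq_one_iff]
  refine Dvd.intro_left 2 ?_
  rw [h.card_eq, Module.natCard_eq_pow_finrank (K := ZMod 2), Nat.card_zmod]

theorem card_le_four (h : IsCyclicHyperplane T π w) : a + 1 ≤ 4 := by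
  have := h.finite
  have hcard : 2 * (a + 1) = 2 ^ Module.finrank (ZMod 2) V := by
    rw [h.card_eq, Module.natCard_eq_pow_finrank (K := ZMod 2), Nat.card_zmod]
  by_contra! ha
  have hdim : 3 < Module.finrank (ZMod 2) V :=
    (Nat.pow_lt_pow_iff_right one_lt_two).1 (by omega)
  obtain ⟨s, hs⟩ := Nat.exists_eq_add_of_lt hdim
  have hle : Module.finrank (ZMod 2) V ≤ 2 ^ (s + 2) := by
    have := Nat.lt_two_pow_self (n := s)
    rw [pow_add]
    omega
  have hdvd : a + 1 ∣ 2 ^ (s + 2) :=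
    (h.pow_eq_one_iff _).1 (pow_char_pow_eq_one_of_finrank_le 2 h.isNilpotent_sub_one hle)
  have := Nat.le_of_dvd (by positivity) hdvd
  rw [hs, show 3 + s + 1 = s + 2 + 2 by ring, pow_add 2 (s + 2)] at hcard
  omega

/-- Translating the cycle by a fixed vector `x` is a rotation of order two, so only the half turn
is possible when `x ≠ 0`. -/
theorem exists_half_turn (h : IsCyclicHyperplane T π w) {x : V} (hx : π x = 0) (hTx : T x = x)
    (hx0 : x ≠ 0) : ∃ k ≠ 0, k + k = 0 ∧ w k = w 0 + x := by
  obtain ⟨k, hk⟩ := h.exists_eq_add_of_map_eq_zero hx 0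
  have hrot : ∀ i, w (i + k) = w i + x := by
    intro i
    induction i using Fin.induction with
    | zero => rw [zero_add, hk]
    | succ i ih =>
      calc w (i.succ + k) = w (finRotate _ (i.castSucc + k)) := by
            rw [finRotate_apply, add_right_comm, Fin.coeSucc_eq_succ]
        _ = T (w i.castSucc) + x := by rw [h.semiconj, ih, map_add, hTx]
        _ = w i.succ + x := by rw [← h.semiconj, finRotate_apply, Fin.coeSucc_eq_succ]
  refine ⟨k, fun hk0 => hx0 ?_, h.injective ?_, hk⟩
  · rwa [hk0, left_eq_add] at hk
  · rw [hrot, hk, add_assoc, ZModModule.add_self, add_zero]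

theorem eq_of_apply_eq_self (h : IsCyclicHyperplane T π w) {x y : V} (hx : π x = 0)
    (hy : π y = 0) (hTx : T x = x) (hTy : T y = y) (hx0 : x ≠ 0) (hy0 : y ≠ 0) : x = y := by
  obtain ⟨k, hk, hkk, hxk⟩ := h.exists_half_turn hx hTx hx0
  obtain ⟨l, hl, hll, hyl⟩ := h.exists_half_turn hy hTy hy0
  rw [fin_eq_of_add_self_eq_zero hk hl hkk hll, hyl] at hxk
  exact (add_left_cancel hxk).symm

end IsCyclicHyperplane

/-- The cosets of the unit errors of an extended 1-perfect code that is closed under a cyclic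
shift, as they sit in the quotient `G` by the code. The binary coordinate `i` contributes
`syndrome (inl i)`; the errors `1` and `-1` at the quaternary coordinate `j` have Gray images `01`
and `10`, so their cosets are `syndrome (inr (j, 1))` and `syndrome (inr (j, 0))`. -/
structure CyclicSyndromes (G : Type*) [AddCommGroup G] (a b : ℕ) where
  shift : G →+ G
  parity : G →+ ZMod 2
  syndrome : Fin (a + 1) ⊕ Fin b × Fin 2 → G
  injective : Function.Injective syndrome
  range_eq : Set.range syndrome = {x | parity x = 1}
  semiconj : Function.Semiconj syndrome (Sum.map (finRotate _) (Prod.map (finRotate _) id)) shift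
  two_nsmul_inl : ∀ i, 2 • syndrome (.inl i) = 0
  inr_zero : ∀ j, syndrome (.inr (j, 0)) = -syndrome (.inr (j, 1))
  four_nsmul_inr_one : ∀ j, 4 • syndrome (.inr (j, 1)) = 0

namespace CyclicSyndromes

variable {G : Type*} [AddCommGroup G] {a b : ℕ} (S : CyclicSyndromes G a b)

/-- The syndrome of the error `1` at the binary coordinate `i`. -/
abbrev e (i : Fin (a + 1)) : G := S.syndrome (.inl i)

/-- The syndrome of the error `1` at the quaternary coordinate `j`. -/
abbrev f (j : Fin b) : G := S.syndrome (.inr (j, 1))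

theorem parity_syndrome (k : Fin (a + 1) ⊕ Fin b × Fin 2) : S.parity (S.syndrome k) = 1 :=
  S.range_eq.subset (Set.mem_range_self k)

theorem exists_syndrome_eq {x : G} (hx : S.parity x = 1) : ∃ k, S.syndrome k = x :=
  S.range_eq.superset hx

theorem semiconj_e : Function.Semiconj S.e (finRotate (a + 1)) S.shift :=
  fun i => S.semiconj (.inl i)

theorem semiconj_f : Function.Semiconj S.f (finRotate b) S.shift :=
  fun j => S.semiconj (.inr (j, 1))

theorem two_nsmul_syndrome_inr (k : Fin b × Fin 2) :
    2 • S.syndrome (.inr k) = 2 • S.f k.1 := by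
  obtain ⟨j, c⟩ := k
  fin_cases c
  · have h4 := S.four_nsmul_inr_one j
    change 2 • S.syndrome (.inr (j, 0)) = _
    rw [S.inr_zero, smul_neg, neg_eq_iff_add_eq_zero, ← add_nsmul]
    exact h4
  · rfl

theorem two_nsmul_f_ne_zero (j : Fin b) : 2 • S.f j ≠ 0 := by
  intro h
  rw [two_nsmul, ← eq_neg_iff_add_eq_zero, ← S.inr_zero] at h
  simpa using S.injective h

theorem exists_e_eq {x : G} (hx : S.parity x = 1) (h2 : 2 • x = 0) : ∃ i, S.e i = x := by
  obtain ⟨i | k, rfl⟩ := S.exists_syndrome_eq hx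
  · exact ⟨i, rfl⟩
  · exact absurd (S.two_nsmul_syndrome_inr k ▸ h2) (S.two_nsmul_f_ne_zero k.1)

/-- The doubles of the odd elements already exhaust `2G`, as adding `e 0` changes the parity. -/
theorem exists_two_nsmul_f_eq {x : G} (hx : 2 • x ≠ 0) : ∃ j, 2 • S.f j = 2 • x := by
  obtain ⟨y, hy, hyx⟩ : ∃ y, S.parity y = 1 ∧ 2 • y = 2 • x := by
    rcases (by decide : ∀ c : ZMod 2, c = 0 ∨ c = 1) (S.parity x) with h | h
    · exact ⟨x + S.e 0, by rw [map_add, h, S.parity_syndrome, zero_add],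
        by rw [smul_add, S.two_nsmul_inl, add_zero]⟩
    · exact ⟨x, h, rfl⟩
  rw [← hyx] at hx ⊢
  obtain ⟨i | k, rfl⟩ := S.exists_syndrome_eq hy
  · exact absurd (S.two_nsmul_inl i) hx
  · exact ⟨k.1, (S.two_nsmul_syndrome_inr k).symm⟩

section TwoTorsion

/-- The elements of `G` killed by `2`, as a vector space over `𝔽₂`. -/
abbrev TwoTorsion (G : Type*) [AddCommGroup G] : Type _ := AddSubgroup.torsionBy G (2 : ℕ)

instance : Module (ZMod 2) (TwoTorsion G) := AddSubgroup.torsionBy.zmodModule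

/-- The restriction of the shift to the elements killed by `2`. -/
def torsionShift : Module.End (ZMod 2) (TwoTorsion G) :=
  ((S.shift.comp (AddSubgroup.subtype _)).codRestrict _ fun x => by
    rw [AddSubgroup.torsionBy.nsmul_iff, AddMonoidHom.comp_apply, ← map_nsmul,
      AddSubgroup.subtype_apply, AddSubgroup.torsionBy.nsmul_iff.1 x.2, map_zero]).toZModLinearMap 2

theorem coe_torsionShift (x : TwoTorsion G) : (S.torsionShift x : G) = S.shift x := rfl

theorem isCyclicHyperplane :
    IsCyclicHyperplane S.torsionShift (S.parity.comp (AddSubgroup.subtype _))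
      fun i => ⟨S.e i, AddSubgroup.torsionBy.nsmul_iff.2 (S.two_nsmul_inl i)⟩ where
  injective i j h := Sum.inl_injective (S.injective (congrArg Subtype.val h))
  range_eq := by
    ext ⟨x, hx⟩
    constructor
    · rintro ⟨i, hi⟩
      obtain rfl : S.e i = x := congrArg Subtype.val hi
      exact S.parity_syndrome (.inl i)
    · intro h
      obtain ⟨i, hi⟩ := S.exists_e_eq h (AddSubgroup.torsionBy.nsmul_iff.1 hx)
      exact ⟨i, Subtype.ext hi⟩
  semiconj i := Subtype.ext (S.semiconj_e i)

theorem eq_of_shift_eq_self {x y : G} (hx : 2 • x = 0) (hy : 2 • y = 0) (hpx : S.parity x = 0)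
    (hpy : S.parity y = 0) (hsx : S.shift x = x) (hsy : S.shift y = y) (hx0 : x ≠ 0)
    (hy0 : y ≠ 0) : x = y := by
  lift x to TwoTorsion G using AddSubgroup.torsionBy.nsmul_iff.2 hx
  lift y to TwoTorsion G using AddSubgroup.torsionBy.nsmul_iff.2 hy
  exact congrArg Subtype.val <| S.isCyclicHyperplane.eq_of_apply_eq_self hpx hpy
    (Subtype.ext hsx) (Subtype.ext hsy) (by simpa using hx0) (by simpa using hy0)

theorem coe_torsionShift_sub_one_pow (n : ℕ) (x : TwoTorsion G) :
    (((S.torsionShift - 1) ^ n) x : G) = (⇑(S.shift - AddMonoidHom.id G))^[n] x := by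
  have h : Function.Semiconj ((↑) : TwoTorsion G → G) ⇑(S.torsionShift - 1)
      ⇑(S.shift - AddMonoidHom.id G) := fun _ => rfl
  rw [Module.End.pow_apply, (h.iterate_right n).eq]

end TwoTorsion

theorem two_nsmul_two_nsmul (S : CyclicSyndromes G a b) (x : G) : 2 • 2 • x = 0 := by
  by_cases hx : 2 • x = 0
  · rw [hx, smul_zero]
  · obtain ⟨j, hj⟩ := S.exists_two_nsmul_f_eq hx
    rw [← hj, smul_smul]
    exact S.four_nsmul_inr_one j

theorem exists_shift_two_nsmul_f_eq_self (j : Fin b) :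
    ∃ k, S.shift (2 • S.f k) = 2 • S.f k := by
  let x : TwoTorsion G :=
    ⟨2 • S.f j, AddSubgroup.torsionBy.nsmul_iff.2 (S.two_nsmul_two_nsmul _)⟩
  have hx : x ≠ 0 := fun h => S.two_nsmul_f_ne_zero j (congrArg Subtype.val h)
  obtain ⟨n, hn0, hn⟩ := exists_pow_apply_mem_ker_of_isNilpotent
    S.isCyclicHyperplane.isNilpotent_sub_one hx
  set y := ((S.torsionShift - 1) ^ n) x
  have hy : (y : G) = 2 • (⇑(S.shift - AddMonoidHom.id G))^[n] (S.f j) := by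
    rw [S.coe_torsionShift_sub_one_pow, ← iterate_map_nsmul]
  have hy0 : (y : G) ≠ 0 := by simpa using hn0
  obtain ⟨k, hk⟩ := S.exists_two_nsmul_f_eq (hy ▸ hy0)
  refine ⟨k, ?_⟩
  rw [hk, ← hy, ← S.coe_torsionShift]
  exact congrArg Subtype.val (sub_eq_zero.1 hn)

theorem two_nsmul_f_eq (j k : Fin b) : 2 • S.f j = 2 • S.f k := by
  obtain ⟨l, hl⟩ := S.exists_shift_two_nsmul_f_eq_self j
  have hconst : ∀ i, 2 • S.f i = 2 • S.f l := by
    intro i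
    obtain ⟨n, rfl⟩ := exists_finRotate_iterate_eq l i
    rw [(S.semiconj_f.iterate_right n).eq, ← iterate_map_nsmul, Function.iterate_fixed hl]
  rw [hconst j, hconst k]

/-- Translation by `f 0 + e 0` maps the `±f j`, which all have the same double, to the `e i`. -/
theorem two_mul_le (S : CyclicSyndromes G a b) : 2 * b ≤ a + 1 := by
  rcases b with _ | b
  · exact Nat.zero_le _
  have htranslate : ∀ k, ∃ i, S.e i = S.syndrome (.inr k) + (S.f 0 + S.e 0) := by
    intro k
    apply S.exists_e_eq
    · simp only [map_add, S.parity_syndrome]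
      decide
    · rw [smul_add, smul_add, S.two_nsmul_inl, add_zero, S.two_nsmul_syndrome_inr,
        S.two_nsmul_f_eq k.1 0, ← two_nsmul, S.two_nsmul_two_nsmul]
  choose φ hφ using htranslate
  have hinj : Function.Injective φ := by
    intro k l hkl
    have hsum := hφ k
    rw [hkl, hφ l] at hsum
    exact (Sum.inr_injective (S.injective (add_right_cancel hsum))).symm
  simpa [mul_comm] using Fintype.card_le_of_injective φ hinj

/-- With two quaternary coordinates, `f 0 + f 1` and `2 • f 0` would both be the unique nonzero
even fixed vector of order two. -/
theorem ne_two (S : CyclicSyndromes G a b) : b ≠ 2 := by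
  rintro rfl
  have hshift0 : S.shift (S.f 0) = S.f 1 := (S.semiconj_f 0).symm
  have hshift1 : S.shift (S.f 1) = S.f 0 := (S.semiconj_f 1).symm
  have hdouble : 2 • S.f 1 = 2 • S.f 0 := S.two_nsmul_f_eq 1 0
  have hsum_ne : S.f 0 + S.f 1 ≠ 0 := fun h => by
    rw [← eq_neg_iff_add_eq_zero, ← S.inr_zero] at h
    simpa using S.injective h
  have hsum : S.f 0 + S.f 1 = 2 • S.f 0 := by
    refine S.eq_of_shift_eq_self ?_ (S.two_nsmul_two_nsmul _) ?_ ?_ ?_ ?_ hsum_ne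
      (S.two_nsmul_f_ne_zero 0)
    · rw [smul_add, hdouble, ← two_nsmul, S.two_nsmul_two_nsmul]
    · rw [map_add, S.parity_syndrome, S.parity_syndrome, CharTwo.add_self_eq_zero]
    · rw [map_nsmul, CharTwo.two_nsmul]
    · rw [map_add, hshift0, hshift1, add_comm]
    · rw [map_nsmul, hshift0, hdouble]
  rw [two_nsmul, add_right_inj] at hsum
  simpa using S.injective hsum

theorem length_lt_eight (S : CyclicSyndromes G a b) : a + 1 + 2 * b < 8 := by
  have := S.isCyclicHyperplane.card_le_four
  have := S.two_mul_le
  have := S.ne_two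
  omega

end CyclicSyndromes

theorem hammingNorm_eq_sum_val {ι : Type*} [Fintype ι] (x : ι → ZMod 2) :
    hammingNorm x = ∑ k, (x k).val := by
  have hval : ∀ c : ZMod 2, (if c ≠ 0 then 1 else 0) = c.val := by decide
  simp only [hammingNorm, Finset.card_filter, hval]

theorem hammingNorm_eq_one_iff {ι : Type*} [Fintype ι] [DecidableEq ι] {x : ι → ZMod 2} :
    hammingNorm x = 1 ↔ ∃ k, Pi.single k 1 = x := by
  have hne_zero_iff : ∀ (c : ZMod 2) (P : Prop) [Decidable P],
      (c ≠ 0 ↔ P) ↔ (if P then 1 else 0) = c := by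
    intro c P _
    by_cases hP : P <;> simp only [hP, if_true, if_false, iff_true, iff_false] <;>
      revert c <;> decide
  simp only [hammingNorm, Finset.card_eq_one, Finset.ext_iff, Finset.mem_filter_univ,
    Finset.mem_singleton, hne_zero_iff, funext_iff, Pi.single_apply]

section GrayMap

variable {α β : ℕ}

theorem gray_injective : Function.Injective gray := by decide

theorem grayMap_injective : Function.Injective (grayMap : Z2Z4 α β → _) := fun _ _ h =>
  Prod.ext (funext fun i => congrFun h (.inl i))
    (funext fun j => gray_injective (funext fun c => congrFun h (.inr (j, c))))

/-- The Lee weight, defined as the Hamming weight of the Gray image. -/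
def leeWeight (u : Z2Z4 α β) : ℕ := hammingNorm (grayMap u)

theorem leeWeight_eq_sum (u : Z2Z4 α β) :
    leeWeight u = ∑ i, (u.1 i).val + ∑ j, ∑ c, (gray (u.2 j) c).val := by
  simp only [leeWeight, hammingNorm_eq_sum_val, grayMap, Fintype.sum_sum_type, Sum.elim_inl,
    Sum.elim_inr, Fintype.sum_prod_type]

theorem natCast_leeWeight (u : Z2Z4 α β) : (leeWeight u : ZMod 2) = parityBit u := by
  simp [leeWeight, hammingNorm_eq_sum_val, parityBit]

theorem hammingDist_grayMap (u v : Z2Z4 α β) :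
    hammingDist (grayMap u) (grayMap v) = leeWeight (u - v) := by
  have hsub : ∀ x y : ZMod 2, -x + y = x - y := by decide
  have hgray : ∀ x y : ZMod 4,
      ∑ c, (gray x c - gray y c).val = ∑ c, (gray (x - y) c).val := by decide
  rw [hammingDist_eq_hammingNorm, hammingNorm_eq_sum_val, leeWeight_eq_sum]
  simp only [Fintype.sum_sum_type, Fintype.sum_prod_type, Pi.add_apply, Pi.neg_apply, grayMap,
    Sum.elim_inl, Sum.elim_inr, hsub, hgray, Prod.fst_sub, Prod.snd_sub, Pi.sub_apply]

/-- The vectors of Lee weight one, indexed by the position of the `1` in their Gray image. -/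
def unitError : Fin α ⊕ Fin β × Fin 2 → Z2Z4 α β
  | .inl i => (Pi.single i 1, 0)
  | .inr (j, c) => (0, Pi.single j (![-1, 1] c))

theorem grayMap_unitError (k : Fin α ⊕ Fin β × Fin 2) :
    grayMap (unitError k) = Pi.single k 1 := by
  have hzero : ∀ c, gray 0 c = 0 := by decide
  have hone : ∀ c d, gray (![-1, 1] c) d = if d = c then 1 else 0 := by decide
  rcases k with i | ⟨j, c⟩ <;> ext (i' | ⟨j', d⟩)
  · simp [grayMap, unitError, Pi.single_apply]
  · simp [grayMap, unitError, hzero]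
  · simp [grayMap, unitError]
  · by_cases hj : j' = j
    · subst hj
      simp [grayMap, unitError, hone, Pi.single_apply]
    · simp [grayMap, unitError, hj, hzero]

theorem unitError_injective : Function.Injective (unitError : _ → Z2Z4 α β) := by
  intro k l h
  have hsingle := congrArg grayMap h
  rw [grayMap_unitError, grayMap_unitError] at hsingle
  by_contra hkl
  have := congrFun hsingle k
  simp [hkl] at this

theorem leeWeight_eq_one_iff {u : Z2Z4 α β} : leeWeight u = 1 ↔ ∃ k, unitError k = u := by
  simp only [leeWeight, hammingNorm_eq_one_iff, ← grayMap_unitError, grayMap_injective.eq_iff]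

theorem leeWeight_unitError (k : Fin α ⊕ Fin β × Fin 2) :
    leeWeight (unitError k : Z2Z4 α β) = 1 :=
  leeWeight_eq_one_iff.2 ⟨k, rfl⟩

end GrayMap

section ExtendedCode

variable {α β : ℕ} {C : AddSubgroup (Z2Z4 α β)}

theorem IsAdditiveOnePerfect.exists_leeWeight_sub_le (hC : IsAdditiveOnePerfect C)
    (y : Z2Z4 α β) : ∃ c ∈ C, leeWeight (y - c) ≤ 1 := by
  obtain ⟨_, ⟨⟨c, hc, rfl⟩, hd⟩, -⟩ := hC (grayMap y)
  exact ⟨c, hc, by rwa [← hammingDist_grayMap]⟩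

theorem IsAdditiveOnePerfect.eq_of_sub_mem (hC : IsAdditiveOnePerfect C) {d d' : Z2Z4 α β}
    (hd : leeWeight d ≤ 1) (hd' : leeWeight d' ≤ 1) (h : d - d' ∈ C) : d = d' := by
  have hgray : grayMap (d - d') = grayMap 0 := (hC (grayMap d)).unique
    ⟨⟨_, h, rfl⟩, by rwa [hammingDist_grayMap, sub_sub_cancel]⟩
    ⟨⟨0, C.zero_mem, rfl⟩, by rwa [hammingDist_grayMap, sub_zero]⟩
  exact sub_eq_zero.1 (grayMap_injective hgray)

/-- Deletion of the `p`-th binary coordinate. -/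
def puncture (p : Fin (α + 1)) : Z2Z4 (α + 1) β →+ Z2Z4 α β :=
  AddMonoidHom.mk' (fun u => (p.removeNth u.1, u.2)) fun _ _ => rfl

theorem leeWeight_eq_add_puncture (p : Fin (α + 1)) (u : Z2Z4 (α + 1) β) :
    leeWeight u = (u.1 p).val + leeWeight (puncture p u) := by
  rw [leeWeight_eq_sum, leeWeight_eq_sum, Fin.sum_univ_succAbove _ p, add_assoc]
  rfl

theorem puncture_extendHom (p : Fin (α + 1)) (u : Z2Z4 α β) : puncture p (extendHom p u) = u :=
  Prod.ext (Fin.removeNth_insertNth (α := fun _ => ZMod 2) p (parityBit u) u.1) rfl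

theorem parityBit_extendHom (p : Fin (α + 1)) (u : Z2Z4 α β) :
    parityBit (extendHom p u) = 0 := by
  have hp : (extendHom p u).1 p = parityBit u :=
    Fin.insertNth_apply_same (α := fun _ => ZMod 2) p (parityBit u) u.1
  rw [← natCast_leeWeight, leeWeight_eq_add_puncture p, puncture_extendHom, Nat.cast_add,
    ZMod.natCast_zmod_val, hp, natCast_leeWeight, CharTwo.add_self_eq_zero]

/-- `parityBit` as a group homomorphism. -/
def parityHom : Z2Z4 α β →+ ZMod 2 := AddMonoidHom.mk' parityBit parityBit_add

theorem extendedCode_le_ker_parityHom (p : Fin (α + 1)) (C : AddSubgroup (Z2Z4 α β)) :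
    extendedCode p C ≤ parityHom.ker := by
  rintro _ ⟨u, -, rfl⟩
  exact parityBit_extendHom p u

/-- The error left after correcting the punctured word has weight at most two, hence one, as it
has the same odd parity as the word itself. -/
theorem IsAdditiveOnePerfect.exists_unitError (hC : IsAdditiveOnePerfect C) (p : Fin (α + 1))
    {x : Z2Z4 (α + 1) β} (hx : parityBit x = 1) :
    ∃ k, x - unitError k ∈ extendedCode p C := by
  obtain ⟨c, hc, hle⟩ := hC.exists_leeWeight_sub_le (puncture p x)
  have hparity : (leeWeight (x - extendHom p c) : ZMod 2) = 1 := by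
    rw [natCast_leeWeight]
    change parityHom _ = 1
    rw [map_sub]
    exact (congrArg₂ (· - ·) hx (parityBit_extendHom p c)).trans (sub_zero 1)
  have hle_two : leeWeight (x - extendHom p c) ≤ 2 := by
    have := leeWeight_eq_add_puncture p (x - extendHom p c)
    have := ZMod.val_lt ((x - extendHom p c).1 p)
    rw [map_sub, puncture_extendHom] at *
    omega
  obtain ⟨k, hk⟩ := leeWeight_eq_one_iff.1 <| show leeWeight (x - extendHom p c) = 1 by
    interval_cases leeWeight (x - extendHom p c)
    · exact absurd hparity (by decide)
    · rfl
    · exact absurd hparity (by decide)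
  exact ⟨k, by rw [hk, sub_sub_cancel]; exact ⟨c, hc, rfl⟩⟩

theorem IsAdditiveOnePerfect.unitError_eq_of_sub_mem (hC : IsAdditiveOnePerfect C)
    (p : Fin (α + 1)) {k l : Fin (α + 1) ⊕ Fin β × Fin 2}
    (h : unitError k - unitError l ∈ extendedCode p C) : k = l := by
  have hle : ∀ k, leeWeight (puncture p (unitError k : Z2Z4 (α + 1) β)) ≤ 1 := fun k => by
    have hsplit := leeWeight_eq_add_puncture p (unitError k : Z2Z4 (α + 1) β)
    rw [leeWeight_unitError] at hsplit
    omega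
  obtain ⟨c, hc, hck⟩ := h
  have hpunct : puncture p (unitError k) - puncture p (unitError l) = c := by
    rw [← map_sub, ← hck, puncture_extendHom]
  obtain rfl : c = 0 := by
    rw [← hpunct, sub_eq_zero]
    exact hC.eq_of_sub_mem (hle k) (hle l) (hpunct ▸ hc)
  rw [map_zero, eq_comm, sub_eq_zero] at hck
  exact unitError_injective hck

/-- `doubleShift` as a group homomorphism. -/
def doubleShiftHom : Z2Z4 α β →+ Z2Z4 α β := AddMonoidHom.mk' doubleShift fun _ _ => rfl

theorem cyclicShift_single {R : Type*} [Zero R] {m : ℕ} (i : Fin m) (c : R) :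
    cyclicShift (Pi.single i c) = Pi.single (finRotate m i) c := by
  funext k
  simp only [cyclicShift, Pi.single_apply, Equiv.symm_apply_eq]

theorem semiconj_unitError : Function.Semiconj (unitError : _ → Z2Z4 α β)
    (Sum.map (finRotate α) (Prod.map (finRotate β) id)) doubleShift
  | .inl i => Prod.ext (cyclicShift_single i 1).symm rfl
  | .inr (j, c) => Prod.ext rfl (cyclicShift_single j (![-1, 1] c)).symm

/-- The syndromes of the unit errors with respect to a cyclic extended 1-perfect code. -/
def IsAdditiveOnePerfect.cyclicSyndromes (hC : IsAdditiveOnePerfect C) (p : Fin (α + 1))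
    (hcyc : IsZ2Z4Cyclic (extendedCode p C)) :
    CyclicSyndromes (Z2Z4 (α + 1) β ⧸ extendedCode p C) α β where
  shift := QuotientAddGroup.map _ _ doubleShiftHom hcyc
  parity := QuotientAddGroup.lift _ parityHom (extendedCode_le_ker_parityHom p C)
  syndrome k := (unitError k : Z2Z4 (α + 1) β)
  injective _ _ h := hC.unitError_eq_of_sub_mem p (QuotientAddGroup.eq_iff_sub_mem.1 h)
  range_eq := by
    refine Set.Subset.antisymm ?_ fun x hx => ?_
    · rintro _ ⟨k, rfl⟩
      change parityBit (unitError k) = 1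
      rw [← natCast_leeWeight, leeWeight_unitError, Nat.cast_one]
    · obtain ⟨x, rfl⟩ := QuotientAddGroup.mk_surjective x
      obtain ⟨k, hk⟩ := hC.exists_unitError p hx
      exact ⟨k, (QuotientAddGroup.eq_iff_sub_mem.2 hk).symm⟩
  semiconj k := congrArg (QuotientAddGroup.mk (s := extendedCode p C)) (semiconj_unitError k)
  two_nsmul_inl i := by
    have h : 2 • (unitError (.inl i) : Z2Z4 (α + 1) β) = 0 :=
      Prod.ext (CharTwo.two_nsmul _) (smul_zero 2)
    rw [← QuotientAddGroup.mk_nsmul, h, QuotientAddGroup.mk_zero]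
  inr_zero j := by
    have h : (unitError (.inr (j, 0)) : Z2Z4 (α + 1) β) = -unitError (.inr (j, 1)) := by
      simp [unitError, Pi.single_neg]
    rw [h, QuotientAddGroup.mk_neg]
  four_nsmul_inr_one j := by
    have four_nsmul : ∀ c : ZMod 4, 4 • c = 0 := by decide
    have h : 4 • (unitError (.inr (j, 1)) : Z2Z4 (α + 1) β) = 0 :=
      Prod.ext (smul_zero 4) (funext fun _ => four_nsmul _)
    rw [← QuotientAddGroup.mk_nsmul, h, QuotientAddGroup.mk_zero]

end ExtendedCode

theorem theorem4p2 (t : ℕ) (ht : 3 ≤ t) (α β : ℕ) (hlen : α + 2 * β = 2 ^ t - 1)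
    (C : AddSubgroup (Z2Z4 α β)) (hC : IsAdditiveOnePerfect C) (p : Fin (α + 1)) :
    ¬ IsZ2Z4Cyclic (extendedCode p C) := by
  intro hcyc
  have hshort : α + 1 + 2 * β < 8 := (hC.cyclicSyndromes p hcyc).length_lt_eight
  have hlong : 2 ^ 3 ≤ 2 ^ t := Nat.pow_le_pow_right two_pos ht
  omega
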